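/- \textbf{Conventions.} A $\mathbf{Cpo}$-category is a category whose hom-sets are $\omega$-complete partial orders (possibly without bottom) and whose composition is $\omega$-continuous; a $\mathbf{Cpo}$-functor is a functor that is $\omega$-continuous on hom-sets. $[\mathcal C,\mathcal D]$ is the $\mathbf{Cpo}$-category of $\mathbf{Cpo}$-functors and natural transformations, ordered componentwise, and $\mathrm{End}(\mathcal C)=[\mathcal C,\mathcal C]$. A $\mathbf{Cpo}$-category $\mathcal D$ is \emph{$\mathbf{Cpo}$-algebraically compact} if every $\mathbf{Cpo}$-endofunctor of $\mathcal D$ has an initial algebra and a final coalgebra and the canonical morphism between them is an isomorphism. $|\nu H|$ denotes the carrier of a chosen final $H$-coalgebra; $|\nu-|$ acts on a natural transformation $\varphi\colon H\to H'$ by coinductive extension of $|\nu H|\to H|\nu H|\xrightarrow{\varphi}H'|\nu H|$. Let $R\colon\mathcal C\to\mathcal D$ be a $\mathbf{Cpo}$-functor, and let $\mathcal P$ be the 2-pullback of $(R\circ-)\colon\mathrm{End}(\mathcal C)\to[\mathcal C,\mathcal D]$ and $(-\circ R)\colon\mathrm{End}(\mathcal D)\to[\mathcal C,\mathcal D]$,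 whose objects are triples $(H,G,R\circ H\cong G\circ R)$. \emph{Final invariants drop along $R$} if, for all objects of $\mathcal P$, $H$ and $G$ have final coalgebras, and $R|\nu H|\cong|\nu G|$ naturally in the object of $\mathcal P$. $\mathrm{Drop}(R)$ is the least sub-$\mathbf{Cpo}$-category of $\mathrm{End}(\mathcal C)$ on the objects $H$ such that $R\circ H\cong G\circ R$ for some $G\in\mathrm{End}(\mathcal D)$ that contains all $h\le h'\colon H\to H'$ such that $Rh\cong gR$ and $Rh'\cong g'R$ for some $g\le g'\colon G\to G'$ in $\mathrm{End}(\mathcal D)$. (A sub-$\mathbf{Cpo}$-category may have a finer order; its inclusion is a $\mathbf{Cpo}$-functor.) For a $\mathbf{Cpo}$-functor $F\colon\mathcal D^{op}\times\mathcal D\to\mathrm{Drop}(R)$, a \emph{solution} of $$H\cong F(R|\nu H|,R|\nu H|)\qquad(*)$$ is an object $H$ of $\mathrm{Drop}(R)$ with such an isomorphism $h$. A \emph{morphism of solutions} $(H,h)\to(H',h')$ is a pair $e\colon H\to H'$, $p\colon H'\to H$ in $\mathrm{Drop}(R)$ with $h'\circ e=F(R|\nu p|,R|\nu e|)\circ h$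 and $h\circ p=F(R|\nu e|,R|\nu p|)\circ h'$. The solution $(H,h)$ is \emph{dominating} if for every solution $(H',h')$ there is a morphism $(e,p)\colon(H,h)\to(H',h')$ with $p\circ e=\mathrm{id}_H$. \textbf{Theorem.} Let $\mathcal D$ be $\mathbf{Cpo}$-algebraically compact, let $R\colon\mathcal C\to\mathcal D$ be a $\mathbf{Cpo}$-functor along which final invariants drop, and let $F\colon\mathcal D^{op}\times\mathcal D\to\mathrm{Drop}(R)$ be a $\mathbf{Cpo}$-functor. Then $(*)$ has a dominating solution, and it is unique up to isomorphism of solutions (a morphism $(e,p)$ with $p\circ e=\mathrm{id}$ and $e\circ p=\mathrm{id}$). More precisely, put $\Phi=R\circ|\nu-|\circ F\colon\mathcal D^{op}\times\mathcal D\to\mathcal D$, and let $\breve F(X,Y)=(\Phi(Y,X),\Phi(X,Y))$ be the induced symmetric endofunctor of $\mathcal D^{op}\times\mathcal D$. There are an object $Z$ of $\mathcal D$ and an isomorphism $z\colon\Phi(Z,Z)\cong Z$ such that $((Z,Z),(z^{-1},z))$ is an initial $\breve F$-algebra, its inverse is a final $\breve F$-coalgebra, and $H=F(Z,Z)$ with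 the isomorphism $F(z,z^{-1})\colon F(Z,Z)\cong F(\Phi(Z,Z),\Phi(Z,Z))$ is a dominating solution. If moreover the hom-sets of $\mathcal D$ have bottoms and composition in $\mathcal D$ is strict in each argument, then every morphism $(e,p)$ from this solution to a solution $(H',h')$ also satisfies $e\circ p\le\mathrm{id}_{H'}$, so that it is a coreflection. -/

import Mathlib

open CategoryTheory Opposite OmegaCompletePartialOrder

universe v u v₁ v₂ v₃ u₁ u₂ u₃

namespace HigherOrder

/-! ### Cpo-enriched categories and functors -/

/-- A `Cpo`-enriched category: every hom-set carries an `ω`-complete partial order, and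
composition is (jointly) `ω`-continuous. -/
class CpoCategory (C : Type u) [Category.{v} C] where
  /-- the order on the hom-sets -/
  homCpo (X Y : C) : OmegaCompletePartialOrder (X ⟶ Y)
  /-- composition is continuous -/
  comp_continuous (X Y Z : C) :
    ωScottContinuous (fun p : (X ⟶ Y) × (Y ⟶ Z) => p.1 ≫ p.2)

attribute [reducible, instance] CpoCategory.homCpo

section Basic

variable {C : Type u₁} [Category.{v₁} C] [CpoCategory C]

theorem comp_mono {X Y Z : C} {f f' : X ⟶ Y} {g g' : Y ⟶ Z} (hf : f ≤ f') (hg : g ≤ g') :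
    f ≫ g ≤ f' ≫ g' :=
  (CpoCategory.comp_continuous X Y Z).monotone
    (show ((f, g) : (X ⟶ Y) × (Y ⟶ Z)) ≤ (f', g') from ⟨hf, hg⟩)

theorem ωSup_comp_ωSup {X Y Z : C} (c : Chain (X ⟶ Y)) (d : Chain (Y ⟶ Z)) :
    ωSup c ≫ ωSup d =
      ωSup (⟨fun n => c n ≫ d n, fun _ _ h => comp_mono (c.monotone h) (d.monotone h)⟩ :
        Chain (X ⟶ Z)) := by
  have h := (CpoCategory.comp_continuous X Y Z).map_ωSup
    (⟨fun n => (c n, d n), fun _ _ h => ⟨c.monotone h, d.monotone h⟩⟩ :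
      Chain ((X ⟶ Y) × (Y ⟶ Z)))
  exact h

theorem ωSup_le_ωSup {α : Type*} [OmegaCompletePartialOrder α] {c d : Chain α}
    (h : ∀ n, c n ≤ d n) : ωSup c ≤ ωSup d :=
  ωSup_le _ _ fun n => (h n).trans (le_ωSup d n)

theorem ωSup_const {α : Type*} [OmegaCompletePartialOrder α] (x : α) (c : Chain α)
    (h : ∀ n, c n = x) : ωSup c = x :=
  le_antisymm (ωSup_le _ _ fun n => (h n).le) ((h 0).ge.trans (le_ωSup c 0))

/-- The order on the hom-sets of the dual category. -/
@[reducible] def opHomOrder (X Y : Cᵒᵖ) : PartialOrder (X ⟶ Y) where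
  le f g := f.unop ≤ g.unop
  le_refl f := le_refl f.unop
  le_trans f g h a b := le_trans (a := f.unop) (b := g.unop) (c := h.unop) a b
  le_antisymm f g a b := Quiver.Hom.unop_inj (le_antisymm (a := f.unop) (b := g.unop) a b)

/-- The hom-sets of the dual category are `ω`-complete. -/
@[reducible] def opHomCpo (X Y : Cᵒᵖ) : OmegaCompletePartialOrder (X ⟶ Y) :=
  letI := opHomOrder X Y
  { opHomOrder X Y with
    ωSup := fun c => (ωSup (⟨fun n => (c n).unop, fun _ _ h => c.monotone h⟩ :
      Chain (unop Y ⟶ unop X))).op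
    le_ωSup := fun c n => le_ωSup (⟨fun n => (c n).unop, fun _ _ h => c.monotone h⟩ :
      Chain (unop Y ⟶ unop X)) n
    ωSup_le := fun c x h => ωSup_le (⟨fun n => (c n).unop, fun _ _ h => c.monotone h⟩ :
      Chain (unop Y ⟶ unop X)) x.unop h }

/-- The dual of a `Cpo`-category. -/
instance instCpoCategoryOp : CpoCategory Cᵒᵖ where
  homCpo := opHomCpo
  comp_continuous X Y Z := by
    let _ := fun X Y : Cᵒᵖ => opHomCpo X Y
    refine ωScottContinuous.of_monotone_map_ωSup ⟨?_, ?_⟩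
    · intro p q h
      exact comp_mono (C := C) h.2 h.1
    · intro c
      apply Quiver.Hom.unop_inj
      exact ωSup_comp_ωSup (C := C)
        (⟨fun n => (c n).2.unop, fun _ _ h => (c.monotone h).2⟩ : Chain (unop Z ⟶ unop Y))
        (⟨fun n => (c n).1.unop, fun _ _ h => (c.monotone h).1⟩ : Chain (unop Y ⟶ unop X))

/-- The componentwise order on the hom-sets of a product category. -/
@[reducible] def prodHomCpo {D : Type u₂} [Category.{v₂} D] [CpoCategory D] (X Y : C × D) :
    OmegaCompletePartialOrder (X ⟶ Y) :=
  inferInstanceAs (OmegaCompletePartialOrder ((X.1 ⟶ Y.1) × (X.2 ⟶ Y.2)))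

/-- The product of two `Cpo`-categories, with the componentwise order. -/
instance instCpoCategoryProd {D : Type u₂} [Category.{v₂} D] [CpoCategory D] :
    CpoCategory (C × D) where
  homCpo := prodHomCpo
  comp_continuous X Y Z := by
    let _ := fun X Y : C × D => prodHomCpo X Y
    refine ωScottContinuous.of_monotone_map_ωSup ⟨?_, ?_⟩
    · intro p q h
      exact ⟨comp_mono h.1.1 h.2.1, comp_mono h.1.2 h.2.2⟩
    · intro c
      refine Prod.ext ?_ ?_
      · exact ωSup_comp_ωSup (C := C)
          (⟨fun n => (c n).1.1, fun _ _ h => (c.monotone h).1.1⟩ : Chain (X.1 ⟶ Y.1))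
          (⟨fun n => (c n).2.1, fun _ _ h => (c.monotone h).2.1⟩ : Chain (Y.1 ⟶ Z.1))
      · exact ωSup_comp_ωSup (C := D)
          (⟨fun n => (c n).1.2, fun _ _ h => (c.monotone h).1.2⟩ : Chain (X.2 ⟶ Y.2))
          (⟨fun n => (c n).2.2, fun _ _ h => (c.monotone h).2.2⟩ : Chain (Y.2 ⟶ Z.2))

end Basic

/-- A `Cpo`-functor: a functor that is `ω`-continuous on hom-sets. -/
structure CpoFunctor (C : Type u₁) [Category.{v₁} C] [CpoCategory C]
    (D : Type u₂) [Category.{v₂} D] [CpoCategory D] extends C ⥤ D where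
  /-- the action on morphisms is continuous -/
  map_continuous (X Y : C) :
    ωScottContinuous (fun f : X ⟶ Y => toFunctor.map f)

namespace CpoFunctor

section

variable {C : Type u₁} [Category.{v₁} C] [CpoCategory C]
variable {D : Type u₂} [Category.{v₂} D] [CpoCategory D]
variable {E : Type u₃} [Category.{v₃} E] [CpoCategory E]

/-- Composition of `Cpo`-functors, in diagrammatic order. -/
def comp (F : CpoFunctor C D) (G : CpoFunctor D E) : CpoFunctor C E where
  toFunctor := F.toFunctor ⋙ G.toFunctor
  map_continuous X Y := by
    refine ωScottContinuous.of_monotone_map_ωSup ⟨?_, ?_⟩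
    · intro f g h
      exact (G.map_continuous _ _).monotone ((F.map_continuous _ _).monotone h)
    · intro c
      show G.map (F.map (ωSup c)) = _
      rw [(F.map_continuous X Y).map_ωSup c]
      exact (G.map_continuous _ _).map_ωSup _

/-- Morphisms of `Cpo`-functors are natural transformations. -/
instance : Category.{max u₁ v₂} (CpoFunctor C D) where
  Hom F G := F.toFunctor ⟶ G.toFunctor
  id F := 𝟙 F.toFunctor
  comp f g := NatTrans.vcomp f g

/-- The natural transformation underlying a morphism of `Cpo`-functors. -/
abbrev nat {F G : CpoFunctor C D} (h : F ⟶ G) : F.toFunctor ⟶ G.toFunctor := h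

/-- The pointwise order on natural transformations. -/
@[reducible] def natOrder (F G : CpoFunctor C D) : PartialOrder (F ⟶ G) where
  le f g := ∀ X, (nat f).app X ≤ (nat g).app X
  le_refl _ _ := le_rfl
  le_trans _ _ _ a b X := (a X).trans (b X)
  le_antisymm _ _ a b := NatTrans.ext (funext fun X => le_antisymm (a X) (b X))

/-- The pointwise order on natural transformations is `ω`-complete. -/
@[reducible] def natCpo (F G : CpoFunctor C D) : OmegaCompletePartialOrder (F ⟶ G) :=
  letI := natOrder F G
  { natOrder F G with
    ωSup := fun c =>
      ({ app := fun X => ωSup (⟨fun n => (nat (c n)).app X, fun _ _ h => c.monotone h X⟩ :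
            Chain (F.obj X ⟶ G.obj X))
         naturality := fun X Y f => by
          have h₁ := ωSup_comp_ωSup
            (⟨fun _ => F.map f, fun _ _ _ => le_rfl⟩ : Chain (F.obj X ⟶ F.obj Y))
            (⟨fun n => (nat (c n)).app Y, fun _ _ h => c.monotone h Y⟩ :
              Chain (F.obj Y ⟶ G.obj Y))
          have h₂ := ωSup_comp_ωSup
            (⟨fun n => (nat (c n)).app X, fun _ _ h => c.monotone h X⟩ :
              Chain (F.obj X ⟶ G.obj X))
            (⟨fun _ => G.map f, fun _ _ _ => le_rfl⟩ : Chain (G.obj X ⟶ G.obj Y))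
          rw [ωSup_const (F.map f) _ (fun _ => rfl)] at h₁
          rw [ωSup_const (G.map f) _ (fun _ => rfl)] at h₂
          rw [h₁, h₂]
          exact le_antisymm (ωSup_le_ωSup fun n => ((nat (c n)).naturality f).le)
            (ωSup_le_ωSup fun n => ((nat (c n)).naturality f).ge) } : F.toFunctor ⟶ G.toFunctor)
    le_ωSup := fun c n X => le_ωSup (⟨fun n => (nat (c n)).app X,
      fun _ _ h => c.monotone h X⟩ : Chain (F.obj X ⟶ G.obj X)) n
    ωSup_le := fun c x h X => ωSup_le (⟨fun n => (nat (c n)).app X,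
      fun _ _ h => c.monotone h X⟩ : Chain (F.obj X ⟶ G.obj X)) _ (fun n => h n X) }

/-- The functor category `[C, D]` is a `Cpo`-category for the pointwise order. -/
instance : CpoCategory (CpoFunctor C D) where
  homCpo := natCpo
  comp_continuous F G H := by
    let _ := fun F G : CpoFunctor C D => natCpo F G
    refine ωScottContinuous.of_monotone_map_ωSup ⟨?_, ?_⟩
    · intro p q h X
      exact comp_mono (h.1 X) (h.2 X)
    · intro c
      refine NatTrans.ext (funext fun X => ?_)
      exact ωSup_comp_ωSup
        (⟨fun n => (nat (c n).1).app X, fun _ _ h => (c.monotone h).1 X⟩ :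
          Chain (F.obj X ⟶ G.obj X))
        (⟨fun n => (nat (c n).2).app X, fun _ _ h => (c.monotone h).2 X⟩ :
          Chain (G.obj X ⟶ H.obj X))

/-- Postcomposition `R ∘ -` with a `Cpo`-functor. -/
def postcomp (R : CpoFunctor C D) : CpoFunctor C C ⥤ CpoFunctor C D where
  obj H := H.comp R
  map h := Functor.whiskerRight (nat h) R.toFunctor
  map_id _ := NatTrans.ext (funext fun _ => R.map_id _)
  map_comp _ _ := NatTrans.ext (funext fun _ => R.map_comp _ _)

/-- Precomposition `- ∘ R` with a `Cpo`-functor. -/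
def precomp (R : CpoFunctor C D) : CpoFunctor D D ⥤ CpoFunctor C D where
  obj G := R.comp G
  map g := Functor.whiskerLeft R.toFunctor (nat g)
  map_id _ := rfl
  map_comp _ _ := rfl

end

end CpoFunctor

open CpoFunctor (postcomp precomp nat)

/-- The `Cpo`-category of `Cpo`-endofunctors of `C`. -/
abbrev Endo (C : Type u) [Category.{v} C] [CpoCategory C] := CpoFunctor C C

/-! ### Algebraic compactness -/

/-- `D` is `Cpo`-algebraically compact: every `Cpo`-endofunctor has an initial algebra and a final
coalgebra, and the canonical morphism from the former to the latter (obtained by regarding the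
inverse of the initial algebra as a coalgebra) is an isomorphism. -/
def IsCpoAlgebraicallyCompact (D : Type u) [Category.{v} D] [CpoCategory D] : Prop :=
  ∀ T : Endo D,
    (∃ A : Endofunctor.Algebra T.toFunctor, Nonempty (Limits.IsInitial A)) ∧
    (∃ B : Endofunctor.Coalgebra T.toFunctor, Nonempty (Limits.IsTerminal B)) ∧
    ∀ (A : Endofunctor.Algebra T.toFunctor) (hA : Limits.IsInitial A)
      (B : Endofunctor.Coalgebra T.toFunctor) (hB : Limits.IsTerminal B),
      IsIso (hB.from ⟨A.a, Endofunctor.Algebra.Initial.strInv hA⟩).f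

/-- `D` is enriched over pointed cpos: hom-sets have least elements and composition is strict. -/
def IsCpoBotEnriched (D : Type u) [Category.{v} D] [CpoCategory D] : Prop :=
  ∃ bot : ∀ X Y : D, X ⟶ Y,
    (∀ (X Y : D) (f : X ⟶ Y), bot X Y ≤ f) ∧
    (∀ (X Y Z : D) (f : X ⟶ Y), f ≫ bot Y Z = bot X Z) ∧
    (∀ (X Y Z : D) (f : Y ⟶ Z), bot X Y ≫ f = bot X Z)

/-! ### Final coalgebras, functorially -/

/-- An assignment of a final coalgebra to each endofunctor of a family `K : J ⥤ Endo C`. -/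
structure FinalCoalgebras {C : Type u₁} [Category.{v₁} C] [CpoCategory C]
    {J : Type u₂} [Category.{v₂} J] (K : J ⥤ Endo C) where
  /-- the assigned coalgebra -/
  coalg (j : J) : Endofunctor.Coalgebra (K.obj j).toFunctor
  /-- the assigned coalgebra is final -/
  isFinal (j : J) : Limits.IsTerminal (coalg j)

/-- The functor `|ν-|` (restricted along `K`), induced by an assignment of final coalgebras: on
objects it is the carrier of the final coalgebra, and it maps `φ : F ⟶ G` to the coinductive
extension of the `G`-coalgebra `|νF| ⟶ F |νF| ⟶ G |νF|`. -/
def FinalCoalgebras.carrier {C : Type u₁} [Category.{v₁} C] [CpoCategory C]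
    {J : Type u₂} [Category.{v₂} J] {K : J ⥤ Endo C} (ν : FinalCoalgebras K) : J ⥤ C where
  obj j := (ν.coalg j).V
  map {i j} f := ((ν.isFinal j).from
    ⟨(ν.coalg i).V, (ν.coalg i).str ≫ (nat (K.map f)).app (ν.coalg i).V⟩).f
  map_id i := by
    have h : (𝟙 (ν.coalg i).V) = (⟨𝟙 (ν.coalg i).V, by
        have e : (nat (K.map (𝟙 i))).app (ν.coalg i).V = 𝟙 _ := by rw [K.map_id]; rfl
        show ((ν.coalg i).str ≫ (nat (K.map (𝟙 i))).app (ν.coalg i).V) ≫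
          (K.obj i).map (𝟙 _) = 𝟙 _ ≫ (ν.coalg i).str
        rw [e, (K.obj i).map_id, Category.comp_id, Category.comp_id, Category.id_comp]⟩ : (⟨(ν.coalg i).V, (ν.coalg i).str ≫ (nat (K.map (𝟙 i))).app (ν.coalg i).V⟩ :
          Endofunctor.Coalgebra (K.obj i).toFunctor) ⟶ ν.coalg i).f := rfl
    rw [h]
    exact congrArg Endofunctor.Coalgebra.Hom.f ((ν.isFinal i).hom_ext _ _)
  map_comp {i j k} f g := by
    let a := (ν.isFinal j).from
      ⟨(ν.coalg i).V, (ν.coalg i).str ≫ (nat (K.map f)).app (ν.coalg i).V⟩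
    let b := (ν.isFinal k).from
      ⟨(ν.coalg j).V, (ν.coalg j).str ≫ (nat (K.map g)).app (ν.coalg j).V⟩
    have ha := a.h
    have hb := b.h
    have h : a.f ≫ b.f = (⟨a.f ≫ b.f, by
        show ((ν.coalg i).str ≫ (nat (K.map (f ≫ g))).app (ν.coalg i).V) ≫
          (K.obj k).map (a.f ≫ b.f) = (a.f ≫ b.f) ≫ (ν.coalg k).str
        have e : (nat (K.map (f ≫ g))).app (ν.coalg i).V =
            (nat (K.map f)).app (ν.coalg i).V ≫ (nat (K.map g)).app (ν.coalg i).V := by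
          rw [K.map_comp]; rfl
        have n := (nat (K.map g)).naturality a.f
        dsimp only at ha hb
        rw [e, Functor.map_comp, Category.assoc a.f, ← hb, ← Category.assoc a.f,
          ← Category.assoc a.f, ← ha]
        simp only [Category.assoc]
        rw [← Category.assoc ((nat (K.map g)).app _), ← n]
        simp only [Category.assoc]⟩ :
          (⟨(ν.coalg i).V, (ν.coalg i).str ≫ (nat (K.map (f ≫ g))).app (ν.coalg i).V⟩ :
          Endofunctor.Coalgebra (K.obj k).toFunctor) ⟶ ν.coalg k).f := rfl
    show _ = a.f ≫ b.f
    rw [h]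
    exact congrArg Endofunctor.Coalgebra.Hom.f ((ν.isFinal k).hom_ext _ _)

/-! ### Dropped endofunctors -/

section Drop

variable {C : Type u₁} [Category.{v₁} C] [CpoCategory C]
variable {D : Type u₂} [Category.{v₂} D] [CpoCategory D]

/-- The 2-pullback of `(R ∘ -) : Endo C ⥤ [C, D]` and `(- ∘ R) : Endo D ⥤ [C, D]`: its objects are
triples `(H, G, R ∘ H ≅ G ∘ R)`. -/
abbrev DropPullback (R : CpoFunctor C D) := Limits.CategoricalPullback (postcomp R) (precomp R)

/-- `h : H ⟶ H'` and `g : G ⟶ G'` satisfy `R h ≅ g R`. -/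
def DropsAlong (R : CpoFunctor C D) {H H' : Endo C} (h : H ⟶ H') {G G' : Endo D} (g : G ⟶ G') :
    Prop :=
  ∃ (φ : (postcomp R).obj H ≅ (precomp R).obj G) (ψ : (postcomp R).obj H' ≅ (precomp R).obj G'),
    (postcomp R).map h ≫ ψ.hom = φ.hom ≫ (precomp R).map g

/-- The order on the hom-sets of the category of dropped endofunctors: the order of the least
sub-`Cpo`-category of `Endo C` (a subcategory together with a possibly finer order for which the
inclusion is a `Cpo`-functor) that contains every `h ≤ h'` such that `R h ≅ g R` and
`R h' ≅ g' R` for some `g ≤ g'` in `Endo D`. A morphism `h` belongs to the subcategory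
when `DropLE R h h`. -/
inductive DropLE (R : CpoFunctor C D) : ∀ {H H' : Endo C}, (H ⟶ H') → (H ⟶ H') → Prop
  | of {H H' : Endo C} {h h' : H ⟶ H'} (hle : h ≤ h') {G G' : Endo D} {g g' : G ⟶ G'}
      (gle : g ≤ g') (hg : DropsAlong R h g) (hg' : DropsAlong R h' g') : DropLE R h h'
  | trans {H H' : Endo C} {h₁ h₂ h₃ : H ⟶ H'} :
      DropLE R h₁ h₂ → DropLE R h₂ h₃ → DropLE R h₁ h₃
  | comp {H H' H'' : Endo C} {h h' : H ⟶ H'} {k k' : H' ⟶ H''} :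
      DropLE R h h' → DropLE R k k' → DropLE R (h ≫ k) (h' ≫ k')
  | le_sup {H H' : Endo C} (c : Chain (H ⟶ H')) (hc : ∀ n, DropLE R (c n) (c (n + 1))) (n : ℕ) :
      DropLE R (c n) (ωSup c)
  | sup_le {H H' : Endo C} (c : Chain (H ⟶ H')) (hc : ∀ n, DropLE R (c n) (c (n + 1)))
      (h : H ⟶ H') (hh : ∀ n, DropLE R (c n) h) : DropLE R (ωSup c) h

theorem DropLE.le {R : CpoFunctor C D} {H H' : Endo C} {h h' : H ⟶ H'} (w : DropLE R h h') :
    h ≤ h' := by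
  induction w with
  | of hle _ _ _ => exact hle
  | trans _ _ ih₁ ih₂ => exact ih₁.trans ih₂
  | comp _ _ ih₁ ih₂ => exact comp_mono ih₁ ih₂
  | le_sup c _ n _ => exact le_ωSup c n
  | sup_le c _ h _ _ ih => exact ωSup_le c h ih

theorem DropLE.refl_left_right {R : CpoFunctor C D} {H H' : Endo C} {h h' : H ⟶ H'}
    (w : DropLE R h h') : DropLE R h h ∧ DropLE R h' h' := by
  induction w with
  | of _ _ hg hg' => exact ⟨.of le_rfl le_rfl hg hg, .of le_rfl le_rfl hg' hg'⟩
  | trans _ _ ih₁ ih₂ => exact ⟨ih₁.1, ih₂.2⟩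
  | comp _ _ ih₁ ih₂ => exact ⟨.comp ih₁.1 ih₂.1, .comp ih₁.2 ih₂.2⟩
  | le_sup c hc n ih => exact ⟨(ih n).1, .sup_le c hc _ (.le_sup c hc)⟩
  | sup_le c hc h hh _ ih => exact ⟨.sup_le c hc _ (.le_sup c hc), (ih 0).2⟩

variable (R : CpoFunctor C D)

/-- The objects of the category of endofunctors dropped along `R`: those `H` with
`R ∘ H ≅ G ∘ R` for some `G`. -/
structure Drop where
  /-- the underlying endofunctor -/
  endo : Endo C
  /-- it is dropped along `R` -/
  dropped : ∃ G : Endo D, Nonempty ((postcomp R).obj endo ≅ (precomp R).obj G)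

variable {R}

/-- The morphisms of the category of endofunctors dropped along `R`. -/
@[ext]
structure Drop.Hom (H H' : Drop R) where
  /-- the underlying natural transformation -/
  hom : H.endo ⟶ H'.endo
  /-- it belongs to the subcategory of dropped transformations -/
  mem : DropLE R hom hom

theorem dropLE_id (H : Drop R) : DropLE R (𝟙 H.endo) (𝟙 H.endo) := by
  obtain ⟨G, ⟨φ⟩⟩ := H.dropped
  have h : DropsAlong R (𝟙 H.endo) (𝟙 G) := ⟨φ, φ, by simp⟩
  exact .of le_rfl le_rfl h h

instance : Category (Drop R) where
  Hom H H' := Drop.Hom H H'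
  id H := ⟨𝟙 H.endo, dropLE_id H⟩
  comp f g := ⟨f.hom ≫ g.hom, .comp f.mem g.mem⟩
  id_comp f := Drop.Hom.ext (Category.id_comp f.hom)
  comp_id f := Drop.Hom.ext (Category.comp_id f.hom)
  assoc f g h := Drop.Hom.ext (Category.assoc f.hom g.hom h.hom)

variable (R) in
/-- The inclusion of the category of dropped endofunctors. -/
def dropInclusion : Drop R ⥤ Endo C where
  obj H := H.endo
  map f := f.hom
  map_id _ := rfl
  map_comp _ _ := rfl

/-- The chain of natural transformations underlying a chain of dropped ones. -/
def dropChain {H H' : Drop R} (c : ℕ → (H ⟶ H'))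
    (hc : ∀ n, DropLE R (c n).hom (c (n + 1)).hom) : Chain (H.endo ⟶ H'.endo) :=
  ⟨fun n => (c n).hom, monotone_nat_of_le_succ fun n => (hc n).le⟩

/-- The order on the hom-sets of the category of dropped endofunctors. -/
@[reducible] def dropOrder (H H' : Drop R) : PartialOrder (H ⟶ H') where
  le f g := DropLE R f.hom g.hom
  le_refl f := f.mem
  le_trans _ _ _ a b := a.trans b
  le_antisymm _ _ a b := Drop.Hom.ext (le_antisymm a.le b.le)

/-- The hom-sets of the category of dropped endofunctors are `ω`-complete. -/
@[reducible] def dropCpo (H H' : Drop R) : OmegaCompletePartialOrder (H ⟶ H') :=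
  letI := dropOrder H H'
  { dropOrder H H' with
    ωSup := fun c => ⟨ωSup (dropChain c fun n => c.monotone n.le_succ),
      .sup_le _ (fun n => c.monotone n.le_succ) _ (.le_sup _ fun n => c.monotone n.le_succ)⟩
    le_ωSup := fun c n => .le_sup (dropChain c fun n => c.monotone n.le_succ)
      (fun n => c.monotone n.le_succ) n
    ωSup_le := fun c x h => .sup_le (dropChain c fun n => c.monotone n.le_succ)
      (fun n => c.monotone n.le_succ) x.hom h }

/-- The category of endofunctors dropped along `R` is a `Cpo`-category. -/
instance : CpoCategory (Drop R) where
  homCpo := dropCpo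
  comp_continuous H H' H'' := by
    let _ := fun H H' : Drop R => dropCpo H H'
    refine ωScottContinuous.of_monotone_map_ωSup ⟨?_, ?_⟩
    · intro p q h
      exact .comp h.1 h.2
    · intro c
      refine Drop.Hom.ext ?_
      exact ωSup_comp_ωSup
        (dropChain (fun n => (c n).1) fun n => (c.monotone n.le_succ).1)
        (dropChain (fun n => (c n).2) fun n => (c.monotone n.le_succ).2)

/-- Final invariants drop along `R`: the endofunctors `H` and `G` occurring in the 2-pullback have
final coalgebras, and `R |νH| ≅ |νG|` naturally in the object `(H, G, R ∘ H ≅ G ∘ R)`. -/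
def FinalInvariantsDrop (R : CpoFunctor C D) : Prop :=
  ∃ (ν₁ : FinalCoalgebras (Limits.CategoricalPullback.π₁ (postcomp R) (precomp R)))
    (ν₂ : FinalCoalgebras (Limits.CategoricalPullback.π₂ (postcomp R) (precomp R))),
    Nonempty (ν₁.carrier ⋙ R.toFunctor ≅ ν₂.carrier)

/-! ### Symmetric endofunctors -/

/-- The symmetric endofunctor on `Dᵒᵖ × D` induced by `Φ : Dᵒᵖ × D ⥤ D`, that is,
`(X, Y) ↦ (Φ (Y, X), Φ (X, Y))`. -/
def symmetric (Φ : Dᵒᵖ × D ⥤ D) : Dᵒᵖ × D ⥤ Dᵒᵖ × D where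
  obj P := (op (Φ.obj (op P.2, P.1.unop)), Φ.obj P)
  map {P Q} f := ((Φ.map (X := (op Q.2, Q.1.unop)) (Y := (op P.2, P.1.unop))
    (f.2.op, f.1.unop)).op, Φ.map f)
  map_id P := by
    refine Prod.ext ?_ (Φ.map_id P)
    exact congrArg Quiver.Hom.op (Φ.map_id (op P.2, P.1.unop))
  map_comp {P Q S} f g := by
    refine Prod.ext ?_ (Φ.map_comp f g)
    exact congrArg Quiver.Hom.op (Φ.map_comp (X := (op S.2, S.1.unop)) (Y := (op Q.2, Q.1.unop))
      (Z := (op P.2, P.1.unop)) (g.2.op, g.1.unop) (f.2.op, f.1.unop))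

/-- The algebra of the symmetric endofunctor carried by `(Z, Z)` that is given by an isomorphism
`Φ (Z, Z) ≅ Z`. -/
def symmetricAlgebra {Φ : Dᵒᵖ × D ⥤ D} {Z : D} (z : Φ.obj (op Z, Z) ≅ Z) :
    Endofunctor.Algebra (symmetric Φ) where
  a := (op Z, Z)
  str := (z.inv.op, z.hom)

/-- The coalgebra of the symmetric endofunctor carried by `(Z, Z)` that is given by an isomorphism
`Φ (Z, Z) ≅ Z`; it is the inverse of `symmetricAlgebra z`. -/
def symmetricCoalgebra {Φ : Dᵒᵖ × D ⥤ D} {Z : D} (z : Φ.obj (op Z, Z) ≅ Z) :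
    Endofunctor.Coalgebra (symmetric Φ) where
  V := (op Z, Z)
  str := (z.hom.op, z.inv)

/-! ### Solutions and domination -/

/-- The functor `H ↦ R |νH|` on the category of dropped endofunctors. -/
def behaviour (ν : FinalCoalgebras (dropInclusion R)) : Drop R ⥤ D := ν.carrier ⋙ R.toFunctor

variable (F : CpoFunctor (Dᵒᵖ × D) (Drop R)) (ν : FinalCoalgebras (dropInclusion R))

/-- A solution of `H ≅ F (R |νH|, R |νH|)`: an endofunctor with such an isomorphism. -/
structure Solution where
  /-- the endofunctor -/
  H : Drop R
  /-- the isomorphism exhibiting it as a solution -/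
  iso : H ≅ F.obj (op ((behaviour ν).obj H), (behaviour ν).obj H)

variable {F ν}

/-- A morphism of solutions `S → T`: a pair `e : S ⟶ T`, `p : T ⟶ S` that commutes with the
isomorphisms exhibiting `S` and `T` as solutions. -/
structure Solution.Hom (S T : Solution F ν) where
  /-- the covariant component -/
  e : S.H ⟶ T.H
  /-- the contravariant component -/
  p : T.H ⟶ S.H
  /-- compatibility of the covariant component -/
  comm_e : e ≫ T.iso.hom = S.iso.hom ≫
    F.map (X := (op ((behaviour ν).obj S.H), (behaviour ν).obj S.H))
      (Y := (op ((behaviour ν).obj T.H), (behaviour ν).obj T.H))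
      (((behaviour ν).map p).op, (behaviour ν).map e)
  /-- compatibility of the contravariant component -/
  comm_p : p ≫ S.iso.hom = T.iso.hom ≫
    F.map (X := (op ((behaviour ν).obj T.H), (behaviour ν).obj T.H))
      (Y := (op ((behaviour ν).obj S.H), (behaviour ν).obj S.H))
      (((behaviour ν).map e).op, (behaviour ν).map p)

/-- `S` dominates `T`: the identity of `S` factors through `T` by a morphism of solutions. -/
def Solution.Dominates (S T : Solution F ν) : Prop :=
  ∃ f : Solution.Hom S T, f.e ≫ f.p = 𝟙 S.H

/-- A solution is dominating when it dominates every solution. -/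
def Solution.IsDominating (S : Solution F ν) : Prop :=
  ∀ T : Solution F ν, S.Dominates T

/-- Two solutions are isomorphic: there is an isomorphism of endofunctors, compatible with the
isomorphisms exhibiting them as solutions. -/
def Solution.IsIsomorphic (S T : Solution F ν) : Prop :=
  ∃ f : Solution.Hom S T, f.e ≫ f.p = 𝟙 S.H ∧ f.p ≫ f.e = 𝟙 T.H

/-- The solution `H = F (Z, Z)` given by a fixed point `z : R |ν F (Z, Z)| ≅ Z`. -/
def Solution.ofFixedPoint {Z : D} (z : (F.toFunctor ⋙ behaviour ν).obj (op Z, Z) ≅ Z) :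
    Solution F ν where
  H := F.obj (op Z, Z)
  iso := F.mapIso (Iso.prod z.op z.symm)

end Drop

end HigherOrder

/-! Put `Φ = behaviour ν ∘ F`. Morphisms of solutions from `Solution.ofFixedPoint z` to `T` amount
to pairs `q : R|νT| ⟶ Z`, `d : Z ⟶ R|νT|` forming an algebra morphism for the symmetric endofunctor
of `Φ`. Everything therefore reduces to an initial algebra of that endofunctor lying on the
diagonal.

`Φ` is a `Cpo`-functor because `|ν-|` sends a transformation to the unique fixed point of an
operator depending continuously on it, and unique fixed points vary continuously with the parameter
(`ωScottContinuous_of_unique_fixedPoint`, `carrier_map_continuous`).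

Compactness is given for `D`, not for `Dᵒᵖ × D`, so the fixed point is built by Bekić's method. Let
`M P` be the compact fixed point of `Φ (P, -)` and `A₀` that of `P ↦ Φ (M P, P)`. The pair `(A₀, M
A₀)` is initial (`bekic_initial`) and receives a morphism from every coalgebra (`bekic_final`). The
symmetry swapping the two arguments then forces `A₀ ≅ M A₀` (`exists_diagonal_fixedPoint`).

Domination and uniqueness hold because an initial algebra has only the identity endomorphism. The
coreflection inequality is a Scott induction from bottom towards the pair `(q, d)`. -/

namespace HigherOrder

open CpoFunctor (nat)

/-! ### Unique fixed points in `ω`-cpos -/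

section FixedPoint

variable {α β : Type*} [OmegaCompletePartialOrder α] [OmegaCompletePartialOrder β]

/-- Scott induction for the unique fixed point of a continuous operator, starting at a
postfixed point. -/
theorem unique_fixedPoint_induction {Ψ : α → α} (hΨ : ωScottContinuous Ψ) {x y : α}
    (hx : x ≤ Ψ x) (hy : ∀ w, Ψ w = w → w = y) (p : α → Prop) (h₀ : p x)
    (hstep : ∀ a, p a → p (Ψ a)) (hsup : ∀ c : Chain α, (∀ n, p (c n)) → p (ωSup c)) : p y := by
  have h := fixedPoints.ωSup_iterate_mem_fixedPoint (ContinuousHom.ofFun Ψ hΨ) x hx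
  rw [← hy _ h]
  refine hsup _ fun n => ?_
  induction n with
  | zero => exact h₀
  | succ n ih =>
    show p (Ψ^[n + 1] x)
    rw [Function.iterate_succ_apply']
    exact hstep _ ih

theorem le_of_unique_fixedPoint {Ψ : α → α} (hΨ : ωScottContinuous Ψ) {x y : α}
    (hx : x ≤ Ψ x) (hy : ∀ w, Ψ w = w → w = y) : x ≤ y :=
  unique_fixedPoint_induction hΨ hx hy (x ≤ ·) le_rfl
    (fun _ ha => hx.trans (hΨ.monotone ha)) fun c hc => (hc 0).trans (le_ωSup c 0)

/-- A unique fixed point depends continuously on the parameter of the operator. -/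
theorem ωScottContinuous_of_unique_fixedPoint {Ψ : β × α → α} (hΨ : ωScottContinuous Ψ)
    {u : β → α} (hu : ∀ b a, Ψ (b, a) = a ↔ a = u b) : ωScottContinuous u := by
  -- For `b ≤ b'`, the point `u b = Ψ (b, u b) ≤ Ψ (b', u b)` is postfixed for the operator at `b'`.
  -- Iteration can start there, so no bottom element is needed.
  have hmono : Monotone u := fun b b' h =>
    le_of_unique_fixedPoint (Ψ := fun a => Ψ (b', a))
      (hΨ.comp (Prod.ωScottContinuous.prodMk .const .id))
      (((hu b _).2 rfl).ge.trans (hΨ.monotone ⟨h, le_rfl⟩)) fun w => (hu b' w).1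
  refine ωScottContinuous.of_monotone_map_ωSup ⟨hmono, fun c => ?_⟩
  -- By joint continuity the supremum of the `u (c n)` is a fixed point at the parameter `ωSup c`;
  -- uniqueness identifies it.
  refine ((hu _ _).1 ?_).symm
  have h := hΨ.map_ωSup (c.zip (c.map ⟨u, hmono⟩))
  rw [Prod.ωSup_zip] at h
  refine h.trans (congrArg ωSup (Chain.ext (funext fun n => ?_)))
  exact (hu _ _).2 rfl

end FixedPoint

/-! ### Mixed-variance functors acting on pairs of morphisms. -/

section Bimap

variable {D : Type u₂} [Category.{v₂} D] {E : Type u₃} [Category.{v₃} E]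

/-- The action of a mixed-variance functor on a pair of morphisms. -/
def bimap (Φ : Dᵒᵖ × D ⥤ E) {X X' Y Y' : D} (f : X' ⟶ X) (g : Y ⟶ Y') :
    Φ.obj (op X, Y) ⟶ Φ.obj (op X', Y') :=
  Φ.map (X := (op X, Y)) (Y := (op X', Y')) (f.op, g)

@[simp] theorem bimap_id (Φ : Dᵒᵖ × D ⥤ E) (X Y : D) : bimap Φ (𝟙 X) (𝟙 Y) = 𝟙 _ :=
  Φ.map_id (op X, Y)

@[simp] theorem bimap_comp (Φ : Dᵒᵖ × D ⥤ E) {X X' X'' Y Y' Y'' : D}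
    (f : X' ⟶ X) (f' : X'' ⟶ X') (g : Y ⟶ Y') (g' : Y' ⟶ Y'') :
    bimap Φ f g ≫ bimap Φ f' g' = bimap Φ (f' ≫ f) (g ≫ g') :=
  (Φ.map_comp (X := (op X, Y)) (Y := (op X', Y')) (Z := (op X'', Y''))
    (f.op, g) (f'.op, g')).symm

@[simp] theorem bimap_comp_assoc (Φ : Dᵒᵖ × D ⥤ E) {X X' X'' Y Y' Y'' : D}
    (f : X' ⟶ X) (f' : X'' ⟶ X') (g : Y ⟶ Y') (g' : Y' ⟶ Y'') {W : E}
    (k : Φ.obj (op X'', Y'') ⟶ W) :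
    bimap Φ f g ≫ bimap Φ f' g' ≫ k = bimap Φ (f' ≫ f) (g ≫ g') ≫ k := by
  rw [← Category.assoc, bimap_comp]

end Bimap

/-! ### Closure properties of continuous families of morphisms. -/

section Continuity

variable {C : Type u₁} [Category.{v₁} C] [CpoCategory C]
variable {D : Type u₂} [Category.{v₂} D] [CpoCategory D]
variable {E : Type u₃} [Category.{v₃} E] [CpoCategory E]

theorem ωScottContinuous_comp {α : Type*} [OmegaCompletePartialOrder α] {X Y Z : C}
    {f : α → (X ⟶ Y)} {g : α → (Y ⟶ Z)} (hf : ωScottContinuous f) (hg : ωScottContinuous g) :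
    ωScottContinuous fun a => f a ≫ g a :=
  (CpoCategory.comp_continuous X Y Z).comp (Prod.ωScottContinuous.prodMk hf hg)

theorem CpoFunctor.ωScottContinuous_map (T : CpoFunctor C D) {α : Type*}
    [OmegaCompletePartialOrder α] {X Y : C} {f : α → (X ⟶ Y)} (hf : ωScottContinuous f) :
    ωScottContinuous fun a => T.map (f a) :=
  (T.map_continuous X Y).comp hf

theorem ωScottContinuous_op {X Y : C} : ωScottContinuous fun f : X ⟶ Y => f.op :=
  ωScottContinuous.of_monotone_map_ωSup ⟨fun _ _ h => h, fun _ => rfl⟩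

theorem ωScottContinuous_bimap (Φ : CpoFunctor (Dᵒᵖ × D) E) {α : Type*}
    [OmegaCompletePartialOrder α] {X X' Y Y' : D} {f : α → (X' ⟶ X)} {g : α → (Y ⟶ Y')}
    (hf : ωScottContinuous f) (hg : ωScottContinuous g) :
    ωScottContinuous fun a => bimap Φ.toFunctor (f a) (g a) :=
  Φ.ωScottContinuous_map (X := (op X, Y)) (Y := (op X', Y')) (f := fun a => ((f a).op, g a))
    (Prod.ωScottContinuous.prodMk (ωScottContinuous_op.comp hf) hg)

theorem bimap_mono (Φ : CpoFunctor (Dᵒᵖ × D) E) {X X' Y Y' : D} {f f' : X' ⟶ X}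
    {g g' : Y ⟶ Y'} (hf : f ≤ f') (hg : g ≤ g') :
    bimap Φ.toFunctor f g ≤ bimap Φ.toFunctor f' g' :=
  (Φ.map_continuous (op X, Y) (op X', Y')).monotone
    (show ((f.op, g) : (op X, Y) ⟶ (op X', Y')) ≤ (f'.op, g') from ⟨hf, hg⟩)

/-- Fixing the contravariant argument of a mixed-variance functor. -/
def fixLeft (Φ : CpoFunctor (Dᵒᵖ × D) E) (P : D) : CpoFunctor D E where
  obj Y := Φ.obj (op P, Y)
  map g := bimap Φ.toFunctor (𝟙 P) g
  map_comp _ _ := by simp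
  map_continuous _ _ := ωScottContinuous_bimap Φ .const .id

end Continuity

/-! ### The behaviour functor is continuous -/

section Behaviour

variable {C : Type u₁} [Category.{v₁} C] [CpoCategory C]
variable {D : Type u₂} [Category.{v₂} D] [CpoCategory D]
variable {R : CpoFunctor C D}

/-- The coinductive extension along `f` is the unique `a` equal to `str ≫ f ≫ H' a ≫ str⁻¹`, and the
right-hand side is jointly continuous in `f` and `a`. -/
theorem carrier_map_continuous (ν : FinalCoalgebras (dropInclusion R)) (H H' : Drop R) :
    ωScottContinuous fun f : H ⟶ H' => ν.carrier.map f := by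
  -- The order on `Drop R` may be finer than the componentwise one, but its suprema of chains are
  -- computed componentwise.
  have happ : ωScottContinuous fun f : H ⟶ H' => (nat f.hom).app (ν.coalg H).V :=
    ωScottContinuous.of_monotone_map_ωSup ⟨fun _ _ h => h.le _, fun _ => rfl⟩
  refine ωScottContinuous_of_unique_fixedPoint
    (Ψ := fun q : (H ⟶ H') × ((ν.coalg H).V ⟶ (ν.coalg H').V) =>
      ((ν.coalg H).str ≫ (nat q.1.hom).app (ν.coalg H).V) ≫ H'.endo.map q.2 ≫
        Endofunctor.Coalgebra.Terminal.strInv (ν.isFinal H')) ?_ ?_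
  · exact ωScottContinuous_comp (ωScottContinuous_comp .const (happ.comp Prod.ωScottContinuous_fst))
      (ωScottContinuous_comp (H'.endo.ωScottContinuous_map Prod.ωScottContinuous_snd) .const)
  · intro f a
    let B : Endofunctor.Coalgebra H'.endo.toFunctor :=
      ⟨(ν.coalg H).V, (ν.coalg H).str ≫ (nat f.hom).app (ν.coalg H).V⟩
    have hl := Endofunctor.Coalgebra.Terminal.left_inv (ν.isFinal H')
    have hr := Endofunctor.Coalgebra.Terminal.right_inv (ν.isFinal H')
    constructor
    · intro h
      have hB : B.str ≫ H'.endo.map a = a ≫ (ν.coalg H').str := by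
        conv_rhs => rw [← h]
        simp only [Category.assoc]
        erw [hl, Category.comp_id]
        rfl
      exact congrArg Endofunctor.Coalgebra.Hom.f
        ((ν.isFinal H').hom_ext (⟨a, hB⟩ : B ⟶ ν.coalg H') ((ν.isFinal H').from B))
    · rintro rfl
      have hB := ((ν.isFinal H').from B).h
      show B.str ≫ _ ≫ _ = ((ν.isFinal H').from B).f
      erw [← Category.assoc, hB, Category.assoc, hr, Category.comp_id]

/-- The functor `H ↦ R |νH|` is a `Cpo`-functor. -/
def cpoBehaviour (ν : FinalCoalgebras (dropInclusion R)) : CpoFunctor (Drop R) D where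
  toFunctor := behaviour ν
  map_continuous H H' := R.ωScottContinuous_map (carrier_map_continuous ν H H')

end Behaviour

/-! ### Fixed points of endofunctors of algebraically compact categories -/

section Compact

variable {D : Type u} [Category.{v} D]

/-- A fixed point of an endofunctor that is both an initial algebra and, inverted, a final
coalgebra. -/
structure CompactFixedPoint (T : D ⥤ D) where
  /-- the carrier -/
  obj : D
  /-- the structure -/
  iso : T.obj obj ≅ obj
  /-- initiality -/
  initial (Y : D) (y : T.obj Y ⟶ Y) : ∃! f : obj ⟶ Y, iso.hom ≫ f = T.map f ≫ y
  /-- finality -/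
  final (Y : D) (y : Y ⟶ T.obj Y) : ∃! f : Y ⟶ obj, f ≫ iso.inv = y ≫ T.map f

variable [CpoCategory D]

/-- The canonical comparison makes the inverted initial algebra isomorphic, as a coalgebra, to a
final one, hence final itself. -/
theorem IsCpoAlgebraicallyCompact.nonempty_compactFixedPoint (hD : IsCpoAlgebraicallyCompact D)
    (T : Endo D) : Nonempty (CompactFixedPoint T.toFunctor) := by
  obtain ⟨⟨A, ⟨hA⟩⟩, ⟨B, ⟨hB⟩⟩, hAB⟩ := hD T
  have hi := hAB A hA B hB
  let A' : Endofunctor.Coalgebra T.toFunctor := ⟨A.a, Endofunctor.Algebra.Initial.strInv hA⟩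
  have : IsIso (hB.from A') := Endofunctor.Coalgebra.iso_of_iso _
  have hA' : Limits.IsTerminal A' := hB.ofIso (asIso (hB.from A')).symm
  refine ⟨⟨A.a, ⟨A.str, Endofunctor.Algebra.Initial.strInv hA,
    Endofunctor.Algebra.Initial.right_inv hA, Endofunctor.Algebra.Initial.left_inv hA⟩, ?_, ?_⟩⟩
  · intro Y y
    let B' : Endofunctor.Algebra T.toFunctor := ⟨Y, y⟩
    refine ⟨(hA.to B').f, (hA.to B').h.symm, fun g hg => ?_⟩
    exact congrArg Endofunctor.Algebra.Hom.f
      (hA.hom_ext (⟨g, hg.symm⟩ : A ⟶ B') (hA.to B'))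
  · intro Y y
    let B' : Endofunctor.Coalgebra T.toFunctor := ⟨Y, y⟩
    refine ⟨(hA'.from B').f, (hA'.from B').h.symm, fun g hg => ?_⟩
    exact congrArg Endofunctor.Coalgebra.Hom.f
      (hA'.hom_ext (⟨g, hg.symm⟩ : B' ⟶ A') (hA'.from B'))

end Compact

/-! ### Bekić's construction: solving for one variable at a time. -/

section Bekic

variable {D : Type u} [Category.{v} D] [CpoCategory D]
variable {Φ : CpoFunctor (Dᵒᵖ × D) D}
variable (M : ∀ P : D, CompactFixedPoint (fixLeft Φ P).toFunctor)

/-- The structure of the fixed point of `Φ (P, -)`. -/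
def paramIso (P : D) : Φ.obj (op P, (M P).obj) ≅ (M P).obj := (M P).iso

theorem param_initial (P Y : D) (y : Φ.obj (op P, Y) ⟶ Y) :
    ∃! f : (M P).obj ⟶ Y, (paramIso M P).hom ≫ f = bimap Φ.toFunctor (𝟙 P) f ≫ y :=
  (M P).initial Y y

theorem param_final (P Y : D) (y : Y ⟶ Φ.obj (op P, Y)) :
    ∃! f : Y ⟶ (M P).obj, f ≫ (paramIso M P).inv = y ≫ bimap Φ.toFunctor (𝟙 P) f :=
  (M P).final Y y

/-- The contravariant action on morphisms of the fixed points of `Φ (P, -)`. -/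
noncomputable def paramMap {P P' : D} (f : P' ⟶ P) : (M P).obj ⟶ (M P').obj :=
  (param_initial M P (M P').obj
    (bimap Φ.toFunctor f (𝟙 _) ≫ (paramIso M P').hom)).choose

/-- Recasts the universal property as a unique fixed point equation in `g` with parameter `f`.
Functoriality and continuity of `paramMap` both come from this form. -/
theorem paramMap_iff {P P' : D} (f : P' ⟶ P) (g : (M P).obj ⟶ (M P').obj) :
    (paramIso M P).inv ≫ bimap Φ.toFunctor f g ≫ (paramIso M P').hom = g ↔
      g = paramMap M f := by
  have h : (paramIso M P).hom ≫ paramMap M f = bimap Φ.toFunctor (𝟙 P) (paramMap M f) ≫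
        bimap Φ.toFunctor f (𝟙 _) ≫ (paramIso M P').hom ∧
      ∀ g, (paramIso M P).hom ≫ g = bimap Φ.toFunctor (𝟙 P) g ≫
        bimap Φ.toFunctor f (𝟙 _) ≫ (paramIso M P').hom → g = paramMap M f :=
    (param_initial M P (M P').obj
      (bimap Φ.toFunctor f (𝟙 _) ≫ (paramIso M P').hom)).choose_spec
  simp only [bimap_comp_assoc, Category.comp_id] at h
  rw [Iso.inv_comp_eq]
  constructor
  · intro hg
    exact h.2 g hg.symm
  · rintro rfl
    exact h.1.symm

theorem paramIso_hom_paramMap {P P' : D} (f : P' ⟶ P) :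
    (paramIso M P).hom ≫ paramMap M f =
      bimap Φ.toFunctor f (paramMap M f) ≫ (paramIso M P').hom := by
  rw [← Iso.eq_inv_comp]
  exact ((paramMap_iff M f _).2 rfl).symm

theorem paramMap_paramIso_inv {P P' : D} (f : P' ⟶ P) :
    paramMap M f ≫ (paramIso M P').inv =
      (paramIso M P).inv ≫ bimap Φ.toFunctor f (paramMap M f) := by
  rw [Iso.comp_inv_eq, Category.assoc]
  exact ((paramMap_iff M f _).2 rfl).symm

@[simp] theorem paramMap_id (P : D) : paramMap M (𝟙 P) = 𝟙 _ :=
  ((paramMap_iff M _ _).1 (by simp)).symm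

@[simp] theorem paramMap_comp {P P' P'' : D} (f : P' ⟶ P) (f' : P'' ⟶ P') :
    paramMap M f ≫ paramMap M f' = paramMap M (f' ≫ f) := by
  refine (paramMap_iff M _ _).1 ?_
  rw [Iso.inv_comp_eq, ← Category.assoc, paramIso_hom_paramMap, Category.assoc,
    paramIso_hom_paramMap, bimap_comp_assoc]

theorem paramMap_continuous (P P' : D) :
    ωScottContinuous fun f : P' ⟶ P => paramMap M f :=
  ωScottContinuous_of_unique_fixedPoint
    (Ψ := fun q : (P' ⟶ P) × ((M P).obj ⟶ (M P').obj) =>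
      (paramIso M P).inv ≫ bimap Φ.toFunctor q.1 q.2 ≫ (paramIso M P').hom)
    (ωScottContinuous_comp .const (ωScottContinuous_comp
      (ωScottContinuous_bimap Φ Prod.ωScottContinuous_fst Prod.ωScottContinuous_snd) .const))
    (paramMap_iff M)

/-- The endofunctor `P ↦ Φ (μ Φ (P, -), P)`. -/
noncomputable def elimination : Endo D where
  obj P := Φ.obj (op (M P).obj, P)
  map f := bimap Φ.toFunctor (paramMap M f) f
  map_id _ := by simp
  map_comp _ _ := by simp
  map_continuous _ _ := ωScottContinuous_bimap Φ (paramMap_continuous M _ _) .id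

variable (N : CompactFixedPoint (elimination M).toFunctor)

/-- The structure of the fixed point of the elimination endofunctor. -/
def elimIso : Φ.obj (op (M N.obj).obj, N.obj) ≅ N.obj := N.iso

theorem elim_initial (Y : D) (y : Φ.obj (op (M Y).obj, Y) ⟶ Y) :
    ∃! f : N.obj ⟶ Y, (elimIso M N).hom ≫ f = bimap Φ.toFunctor (paramMap M f) f ≫ y :=
  N.initial Y y

theorem elim_final (Y : D) (y : Y ⟶ Φ.obj (op (M Y).obj, Y)) :
    ∃! f : Y ⟶ N.obj, f ≫ (elimIso M N).inv = y ≫ bimap Φ.toFunctor (paramMap M f) f :=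
  N.final Y y

/-- Let `g : M A ⟶ B` be the fold of `b`. Initiality of `M N.obj` forces the second component to be
`paramMap M r ≫ g`, where `r` is the first. What remains is a condition on `r` alone: being a
morphism into the final coalgebra `N`. -/
theorem bekic_initial (A B : D) (a : A ⟶ Φ.obj (op B, A)) (b : Φ.obj (op A, B) ⟶ B) :
    ∃! q : (A ⟶ N.obj) × ((M N.obj).obj ⟶ B),
      (paramIso M N.obj).hom ≫ q.2 = bimap Φ.toFunctor q.1 q.2 ≫ b ∧
      q.1 ≫ (elimIso M N).inv = a ≫ bimap Φ.toFunctor q.2 q.1 := by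
  obtain ⟨g, hg, -⟩ := param_initial M A B b
  obtain ⟨p, hp, hp'⟩ := elim_final M N A (a ≫ bimap Φ.toFunctor g (𝟙 A))
  simp only [Category.assoc, bimap_comp, Category.id_comp] at hp hp'
  have key (r : A ⟶ N.obj) : (paramIso M N.obj).hom ≫ paramMap M r ≫ g =
      bimap Φ.toFunctor r (paramMap M r ≫ g) ≫ b := by
    rw [← Category.assoc, paramIso_hom_paramMap, Category.assoc, hg, bimap_comp_assoc,
      Category.id_comp]
  refine ⟨(p, paramMap M p ≫ g), ⟨key p, hp⟩, ?_⟩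
  rintro ⟨r, s⟩ ⟨h₁, h₂⟩
  have hs : s = paramMap M r ≫ g :=
    (param_initial M N.obj B (bimap Φ.toFunctor r (𝟙 B) ≫ b)).unique
      (by simpa using h₁) (by simpa using key r)
  subst hs
  obtain rfl := hp' r h₂
  rfl

/-- Dual to `bekic_initial`, with finality of `M` and initiality of `N`. Existence alone is enough
for the diagonal argument. -/
theorem bekic_final (A B : D) (a : Φ.obj (op B, A) ⟶ A) (b : B ⟶ Φ.obj (op A, B)) :
    ∃ (e : N.obj ⟶ A) (p : B ⟶ (M N.obj).obj),
      (elimIso M N).hom ≫ e = bimap Φ.toFunctor p e ≫ a ∧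
      p ≫ (paramIso M N.obj).inv = b ≫ bimap Φ.toFunctor e p := by
  obtain ⟨g, hg, -⟩ := param_final M A B b
  obtain ⟨e, he, -⟩ := elim_initial M N A (bimap Φ.toFunctor g (𝟙 A) ≫ a)
  refine ⟨e, g ≫ paramMap M e, by simpa using he, ?_⟩
  rw [Category.assoc, paramMap_paramIso_inv, ← Category.assoc, hg, Category.assoc, bimap_comp,
    Category.comp_id]

end Bekic

/-- A mixed-variance `Cpo`-endofunctor of an algebraically compact category has a fixed point on
the diagonal that is initial for the induced symmetric endofunctor. -/
theorem IsCpoAlgebraicallyCompact.exists_diagonal_fixedPoint {D : Type u} [Category.{v} D]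
    [CpoCategory D] (hD : IsCpoAlgebraicallyCompact D) (Φ : CpoFunctor (Dᵒᵖ × D) D) :
    ∃ (Z : D) (z : Φ.obj (op Z, Z) ≅ Z),
      ∀ (A B : D) (a : A ⟶ Φ.obj (op B, A)) (b : Φ.obj (op A, B) ⟶ B),
        ∃! q : (A ⟶ Z) × (Z ⟶ B),
          z.hom ≫ q.2 = bimap Φ.toFunctor q.1 q.2 ≫ b ∧
          q.1 ≫ z.inv = a ≫ bimap Φ.toFunctor q.2 q.1 := by
  have M (P : D) := (hD.nonempty_compactFixedPoint (fixLeft Φ P)).some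
  have N := (hD.nonempty_compactFixedPoint (elimination M)).some
  have init := bekic_initial M N
  have fin := bekic_final M N
  -- From here on only the universal properties of the pair `(A₀, B₀)` matter, not its construction.
  generalize elimIso M N = α at init fin
  generalize paramIso M N.obj = β at init fin
  generalize N.obj = A₀ at α β init fin
  generalize (M A₀).obj = B₀ at α β init fin
  -- The target is the same fixed point with its components swapped. Its two equations are exchanged
  -- by swapping `s` and `t`, so uniqueness gives `t = s`.
  obtain ⟨⟨s, t⟩, ⟨h₁, h₂⟩, hu⟩ := init B₀ A₀ β.inv α.hom
  dsimp only at h₁ h₂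
  have h₃ : β.hom ≫ s = bimap Φ.toFunctor t s ≫ α.hom := by
    rw [← Iso.eq_inv_comp, ← Category.assoc, ← h₂, Category.assoc, α.inv_hom_id,
      Category.comp_id]
  have h₄ : t ≫ α.inv = β.inv ≫ bimap Φ.toFunctor s t := by
    rw [Iso.eq_inv_comp, ← Category.assoc, h₁, Category.assoc, α.hom_inv_id, Category.comp_id]
  obtain rfl : t = s := congrArg Prod.fst (hu (t, s) ⟨h₃, h₄⟩)
  obtain ⟨e, p, h₅, h₆⟩ := fin B₀ A₀ β.hom α.inv
  -- The morphism to the swapped pair followed by the one back is an endomorphism of the initial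
  -- algebra, hence the identity. So `t : B₀ ⟶ A₀` is invertible, with inverse `p = e`.
  have hid := (init A₀ B₀ α.inv β.hom).unique (y₁ := (p ≫ t, t ≫ e)) (y₂ := (𝟙 _, 𝟙 _))
    ⟨by
      dsimp only
      rw [← Category.assoc, h₁, Category.assoc, h₅, bimap_comp_assoc], by
      dsimp only
      rw [Category.assoc, h₂, ← Category.assoc, h₆, Category.assoc, bimap_comp]⟩ (by simp)
  have hpt : p ≫ t = 𝟙 _ := congrArg Prod.fst hid
  have hte : t ≫ e = 𝟙 _ := congrArg Prod.snd hid
  obtain rfl : p = e := by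
    rw [← Category.comp_id p, ← hte, ← Category.assoc, hpt, Category.id_comp]
  -- Take `Z = B₀` and transport the structure `β` and the universal property along `A₀ ≅ B₀`.
  refine ⟨B₀, ⟨bimap Φ.toFunctor p (𝟙 _) ≫ β.hom, β.inv ≫ bimap Φ.toFunctor t (𝟙 _), by
    simp [hte], by simp [hpt]⟩, fun A B a b => ?_⟩
  obtain ⟨⟨q, r⟩, ⟨h₇, h₈⟩, hv⟩ := init A B a b
  dsimp only at h₇ h₈
  refine ⟨(q ≫ p, r), ⟨?_, ?_⟩, ?_⟩
  · dsimp only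
    rw [Category.assoc, h₇, bimap_comp_assoc, Category.id_comp]
  · dsimp only
    rw [Category.assoc, ← Category.assoc p, h₆, Category.assoc, bimap_comp, ← Category.assoc q,
      h₈, Category.assoc, bimap_comp, hte, Category.id_comp, Category.comp_id]
  · rintro ⟨q', r'⟩ ⟨h₉, h₁₀⟩
    dsimp only at h₉ h₁₀
    have h := hv (q' ≫ t, r') ⟨?_, ?_⟩
    · obtain ⟨rfl, rfl⟩ := Prod.ext_iff.1 h
      simp [hte]
    · dsimp only
      have h := congrArg (fun k => bimap Φ.toFunctor t (𝟙 _) ≫ k) h₉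
      simpa [hpt, hte] using h
    · have h := congrArg (fun k => k ≫ bimap Φ.toFunctor (𝟙 _) t) h₁₀
      dsimp only
      rw [Category.assoc, h₂]
      simpa using h

/-! ### From the diagonal universal property to initial algebras and final coalgebras. -/

section Symmetric

variable {D : Type u} [Category.{v} D]

/-- Initiality of the diagonal algebra given by `z : Φ (Z, Z) ≅ Z`, in terms of `D` alone. -/
def IsDiagonalInitial (Φ : Dᵒᵖ × D ⥤ D) {Z : D} (z : Φ.obj (op Z, Z) ≅ Z) : Prop :=
  ∀ (A B : D) (a : A ⟶ Φ.obj (op B, A)) (b : Φ.obj (op A, B) ⟶ B),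
    ∃! q : (A ⟶ Z) × (Z ⟶ B),
      z.hom ≫ q.2 = bimap Φ q.1 q.2 ≫ b ∧ q.1 ≫ z.inv = a ≫ bimap Φ q.2 q.1

variable {Φ : Dᵒᵖ × D ⥤ D} {Z : D} {z : Φ.obj (op Z, Z) ≅ Z}

theorem IsDiagonalInitial.nonempty_isInitial (hz : IsDiagonalInitial Φ z) :
    Nonempty (Limits.IsInitial (symmetricAlgebra z)) := by
  have (Q : Endofunctor.Algebra (symmetric Φ)) : Unique (symmetricAlgebra z ⟶ Q) := by
    have hq := hz Q.a.1.unop Q.a.2 Q.str.1.unop Q.str.2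
    refine ⟨⟨⟨(hq.choose.1.op, hq.choose.2), ?_⟩⟩, fun f => ?_⟩
    · refine Prod.ext ?_ hq.choose_spec.1.1.symm
      exact Quiver.Hom.unop_inj hq.choose_spec.1.2.symm
    · have h : (f.f.1.unop, f.f.2) = hq.choose := hq.choose_spec.2 (f.f.1.unop, f.f.2)
        ⟨(congrArg Prod.snd f.h).symm, (congrArg (fun k => Quiver.Hom.unop (Prod.fst k)) f.h).symm⟩
      refine Endofunctor.Algebra.Hom.ext (Prod.ext ?_
        (show f.f.2 = hq.choose.2 from congrArg Prod.snd h))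
      exact Quiver.Hom.unop_inj (congrArg Prod.fst h)
  exact ⟨Limits.IsInitial.ofUnique _⟩

/-- The symmetric endofunctor is self-dual: a coalgebra on `(X, Y)` is an algebra on `(Y, X)`. The
same property thus applies with the two components exchanged. -/
theorem IsDiagonalInitial.nonempty_isTerminal (hz : IsDiagonalInitial Φ z) :
    Nonempty (Limits.IsTerminal (symmetricCoalgebra z)) := by
  have (Q : Endofunctor.Coalgebra (symmetric Φ)) : Unique (Q ⟶ symmetricCoalgebra z) := by
    have hq := hz Q.V.2 Q.V.1.unop Q.str.2 Q.str.1.unop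
    refine ⟨⟨⟨(hq.choose.2.op, hq.choose.1), ?_⟩⟩, fun f => ?_⟩
    · refine Prod.ext ?_ hq.choose_spec.1.2.symm
      exact Quiver.Hom.unop_inj hq.choose_spec.1.1.symm
    · have h : (f.f.2, f.f.1.unop) = hq.choose := hq.choose_spec.2 (f.f.2, f.f.1.unop)
        ⟨(congrArg (fun k => Quiver.Hom.unop (Prod.fst k)) f.h).symm, (congrArg Prod.snd f.h).symm⟩
      refine Endofunctor.Coalgebra.Hom.ext (Prod.ext ?_ (congrArg Prod.fst h))
      exact Quiver.Hom.unop_inj (congrArg Prod.snd h)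
  exact ⟨Limits.IsTerminal.ofUnique _⟩

end Symmetric

/-! ### Solutions, domination and coreflections. -/

section Solutions

variable {C : Type u₁} [Category.{v₁} C] [CpoCategory C]
variable {D : Type u₂} [Category.{v₂} D] [CpoCategory D]
variable {R : CpoFunctor C D} {F : CpoFunctor (Dᵒᵖ × D) (Drop R)}
variable {ν : FinalCoalgebras (dropInclusion R)}

namespace Solution

/-- The composition of morphisms of solutions. -/
def Hom.comp {S T U : Solution F ν} (f : Hom S T) (g : Hom T U) : Hom S U where
  e := f.e ≫ g.e
  p := g.p ≫ f.p
  comm_e := by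
    have h := bimap_comp F.toFunctor ((behaviour ν).map f.p) ((behaviour ν).map g.p)
      ((behaviour ν).map f.e) ((behaviour ν).map g.e)
    rw [← Functor.map_comp, ← Functor.map_comp] at h
    refine Eq.trans ?_ (congrArg (S.iso.hom ≫ ·) h)
    rw [Category.assoc, g.comm_e, ← Category.assoc, f.comm_e, Category.assoc]
    rfl
  comm_p := by
    have h := bimap_comp F.toFunctor ((behaviour ν).map g.e) ((behaviour ν).map f.e)
      ((behaviour ν).map g.p) ((behaviour ν).map f.p)
    rw [← Functor.map_comp, ← Functor.map_comp] at h
    refine Eq.trans ?_ (congrArg (U.iso.hom ≫ ·) h)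
    rw [Category.assoc, f.comm_p, ← Category.assoc, g.comm_p, Category.assoc]
    rfl

/-- The identity morphism of a solution. -/
def Hom.id (S : Solution F ν) : Hom S S where
  e := 𝟙 _
  p := 𝟙 _
  comm_e := by
    have h := bimap_id F.toFunctor ((behaviour ν).obj S.H) ((behaviour ν).obj S.H)
    rw [← (behaviour ν).map_id] at h
    refine Eq.trans ?_ (congrArg (S.iso.hom ≫ ·) h.symm)
    simp
  comm_p := by
    have h := bimap_id F.toFunctor ((behaviour ν).obj S.H) ((behaviour ν).obj S.H)
    rw [← (behaviour ν).map_id] at h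
    refine Eq.trans ?_ (congrArg (S.iso.hom ≫ ·) h.symm)
    simp

variable {Z : D} {z : (behaviour ν).obj (F.obj (op Z, Z)) ≅ Z} {T : Solution F ν}

/-- The morphism of solutions induced by a morphism of fixed points. -/
def Hom.ofFixedPoint (q : (behaviour ν).obj T.H ⟶ Z) (d : Z ⟶ (behaviour ν).obj T.H)
    (h₁ : z.hom ≫ d = (behaviour ν).map (bimap F.toFunctor q d) ≫ (behaviour ν).map T.iso.inv)
    (h₂ : q ≫ z.inv = (behaviour ν).map T.iso.hom ≫ (behaviour ν).map (bimap F.toFunctor d q)) :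
    Hom (Solution.ofFixedPoint z) T where
  e := bimap F.toFunctor q d ≫ T.iso.inv
  p := T.iso.hom ≫ bimap F.toFunctor d q
  comm_e := by
    -- By `h₁` and `h₂`, `behaviour ν` sends `e` to `z.hom ≫ d` and `p` to `q ≫ z.inv`, so `z`
    -- cancels against its inverse in both arguments.
    have h : bimap F.toFunctor q d = bimap F.toFunctor z.hom z.inv ≫ bimap F.toFunctor
        ((behaviour ν).map (T.iso.hom ≫ bimap F.toFunctor d q))
        ((behaviour ν).map (bimap F.toFunctor q d ≫ T.iso.inv)) := by
      rw [Functor.map_comp, Functor.map_comp, ← h₁, ← h₂]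
      simp
    refine Eq.trans ((Category.assoc _ _ _).trans ?_) h
    exact (congrArg (bimap F.toFunctor q d ≫ ·) T.iso.inv_hom_id).trans (Category.comp_id _)
  comm_p := by
    have h : bimap F.toFunctor d q ≫ bimap F.toFunctor z.hom z.inv = bimap F.toFunctor
        ((behaviour ν).map (bimap F.toFunctor q d ≫ T.iso.inv))
        ((behaviour ν).map (T.iso.hom ≫ bimap F.toFunctor d q)) := by
      rw [Functor.map_comp, Functor.map_comp, ← h₁, ← h₂]
      simp
    exact (Category.assoc _ _ _).trans (congrArg (T.iso.hom ≫ ·) h)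

/-- The component `R |νT| ⟶ Z` of the morphism of fixed points underlying a morphism of
solutions. -/
def Hom.q (f : Hom (Solution.ofFixedPoint z) T) : (behaviour ν).obj T.H ⟶ Z :=
  (behaviour ν).map (Y := F.obj (op Z, Z)) f.p ≫ z.hom

/-- The component `Z ⟶ R |νT|` of the morphism of fixed points underlying a morphism of
solutions. -/
def Hom.d (f : Hom (Solution.ofFixedPoint z) T) : Z ⟶ (behaviour ν).obj T.H :=
  z.inv ≫ (behaviour ν).map (X := F.obj (op Z, Z)) f.e

/-- With `Hom.p_eq`, shows that a morphism of solutions is determined by its pair `(q, d)`. Applying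
`behaviour ν` to both formulas gives `Hom.hom_d` and `Hom.q_inv`, the equations of an algebra
morphism. -/
theorem Hom.e_eq (f : Hom (Solution.ofFixedPoint z) T) :
    f.e = bimap F.toFunctor f.q f.d ≫ T.iso.inv :=
  (Iso.eq_comp_inv T.iso).2 (f.comm_e.trans (bimap_comp F.toFunctor _ _ _ _))

theorem Hom.p_eq (f : Hom (Solution.ofFixedPoint z) T) :
    f.p = T.iso.hom ≫ bimap F.toFunctor f.d f.q := by
  have h : f.p = (T.iso.hom ≫ bimap F.toFunctor _ _) ≫ bimap F.toFunctor z.inv z.hom :=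
    (Iso.eq_comp_inv (Solution.ofFixedPoint z).iso).2 f.comm_p
  exact h.trans ((Category.assoc _ _ _).trans
    (congrArg (T.iso.hom ≫ ·) (bimap_comp F.toFunctor _ _ _ _)))

theorem Hom.hom_d (f : Hom (Solution.ofFixedPoint z) T) :
    z.hom ≫ f.d =
      (behaviour ν).map (bimap F.toFunctor f.q f.d) ≫ (behaviour ν).map T.iso.inv := by
  rw [Hom.d, Iso.hom_inv_id_assoc]
  exact (congrArg (behaviour ν).map f.e_eq).trans ((behaviour ν).map_comp _ _)

theorem Hom.q_inv (f : Hom (Solution.ofFixedPoint z) T) :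
    f.q ≫ z.inv =
      (behaviour ν).map T.iso.hom ≫ (behaviour ν).map (bimap F.toFunctor f.d f.q) := by
  rw [Hom.q, Category.assoc, Iso.hom_inv_id, Category.comp_id]
  exact (congrArg (behaviour ν).map f.p_eq).trans ((behaviour ν).map_comp _ _)

/-- A solution `T` makes `R|νT|` a diagonal fixed point of `Φ`, with structure the image of `T.iso`
under `behaviour ν`. -/
theorem existsUnique_of_isDiagonalInitial
    (hz : IsDiagonalInitial (F.toFunctor ⋙ behaviour ν) z) (T : Solution F ν) :
    ∃! w : ((behaviour ν).obj T.H ⟶ Z) × (Z ⟶ (behaviour ν).obj T.H),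
      z.hom ≫ w.2 =
        (behaviour ν).map (bimap F.toFunctor w.1 w.2) ≫ (behaviour ν).map T.iso.inv ∧
      w.1 ≫ z.inv =
        (behaviour ν).map T.iso.hom ≫ (behaviour ν).map (bimap F.toFunctor w.2 w.1) :=
  hz _ _ _ _

theorem Hom.e_p_unique (hz : IsDiagonalInitial (F.toFunctor ⋙ behaviour ν) z)
    (f g : Hom (Solution.ofFixedPoint z) T) : f.e = g.e ∧ f.p = g.p := by
  have h := (existsUnique_of_isDiagonalInitial hz T).unique (y₁ := (f.q, f.d)) (y₂ := (g.q, g.d))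
    ⟨f.hom_d, f.q_inv⟩ ⟨g.hom_d, g.q_inv⟩
  obtain ⟨hq, hd⟩ := Prod.ext_iff.1 h
  dsimp only at hq hd
  rw [f.e_eq, g.e_eq, f.p_eq, g.p_eq, hq, hd]
  exact ⟨rfl, rfl⟩

theorem isDominating_of_isDiagonalInitial
    (hz : IsDiagonalInitial (F.toFunctor ⋙ behaviour ν) z) :
    (Solution.ofFixedPoint z : Solution F ν).IsDominating := by
  intro T
  obtain ⟨⟨q, d⟩, ⟨h₁, h₂⟩, -⟩ := existsUnique_of_isDiagonalInitial hz T
  dsimp only at h₁ h₂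
  refine ⟨.ofFixedPoint q d h₁ h₂, ?_⟩
  -- The composite `d ≫ q`, taken in both components, is an endomorphism of the initial algebra.
  -- Hence `d ≫ q = 𝟙 Z`, and `e ≫ p` is `F` applied to this identity.
  have hid := (hz Z Z z.inv z.hom).unique (y₁ := (d ≫ q, d ≫ q)) (y₂ := (𝟙 _, 𝟙 _))
    ⟨?_, ?_⟩ (by simp)
  · have hdq : d ≫ q = 𝟙 Z := congrArg Prod.fst hid
    show (bimap F.toFunctor q d ≫ T.iso.inv) ≫ T.iso.hom ≫ bimap F.toFunctor d q = 𝟙 _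
    rw [Category.assoc, Iso.inv_hom_id_assoc, bimap_comp, hdq, bimap_id]
  · have h₃ : (behaviour ν).map T.iso.inv ≫ q =
        (behaviour ν).map (bimap F.toFunctor d q) ≫ z.hom := by
      rw [← Iso.comp_inv_eq, Category.assoc, h₂]
      exact ((behaviour ν).mapIso T.iso).inv_hom_id_assoc _
    have h₄ : z.hom ≫ d ≫ q =
        (behaviour ν).map (bimap F.toFunctor (d ≫ q) (d ≫ q)) ≫ z.hom := by
      rw [← bimap_comp, Functor.map_comp, ← Category.assoc, h₁, Category.assoc, Category.assoc, h₃]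
    exact h₄
  · have h₃ : d ≫ (behaviour ν).map T.iso.hom =
        z.inv ≫ (behaviour ν).map (bimap F.toFunctor q d) := by
      rw [Iso.eq_inv_comp, ← Category.assoc, h₁, Category.assoc]
      exact (congrArg (_ ≫ ·) ((behaviour ν).mapIso T.iso).inv_hom_id).trans (Category.comp_id _)
    have h₄ : (d ≫ q) ≫ z.inv =
        z.inv ≫ (behaviour ν).map (bimap F.toFunctor (d ≫ q) (d ≫ q)) := by
      rw [← bimap_comp, Functor.map_comp, Category.assoc, h₂, ← Category.assoc, h₃, Category.assoc]
    exact h₄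

theorem isIsomorphic_of_isDiagonalInitial
    (hz : IsDiagonalInitial (F.toFunctor ⋙ behaviour ν) z) (hT : T.IsDominating) :
    (Solution.ofFixedPoint z : Solution F ν).IsIsomorphic T := by
  obtain ⟨f, hf⟩ := isDominating_of_isDiagonalInitial hz T
  obtain ⟨g, hg⟩ := hT (Solution.ofFixedPoint z)
  -- Composing the two dominations gives an endomorphism of the initial solution, hence the
  -- identity. Together with `hg` this makes `g` equal to `f` with its components exchanged.
  obtain ⟨h₁, h₂⟩ := Hom.e_p_unique hz (f.comp g) (Hom.id _)
  have h₁ : f.e ≫ g.e = 𝟙 _ := h₁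
  have h₂ : g.p ≫ f.p = 𝟙 _ := h₂
  have h₃ : g.p = f.e := by
    rw [← Category.id_comp g.p, ← h₁, Category.assoc, hg, Category.comp_id]
  have h₄ : g.e = f.p := by
    rw [← Category.comp_id g.e, ← h₂, ← Category.assoc, hg, Category.id_comp]
  exact ⟨f, hf, by rw [← h₃, ← h₄, hg]⟩

theorem Hom.p_e_le_id (hz : IsDiagonalInitial (F.toFunctor ⋙ behaviour ν) z)
    (hD : IsCpoBotEnriched D) (f : Hom (Solution.ofFixedPoint z) T) : f.p ≫ f.e ≤ 𝟙 T.H := by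
  obtain ⟨bot, hbot, -, hcomp⟩ := hD
  let X := (behaviour ν).obj T.H
  let Φ : CpoFunctor (Dᵒᵖ × D) D := F.comp (cpoBehaviour ν)
  let x : X ≅ Φ.obj (op X, X) := (behaviour ν).mapIso T.iso
  let z' : Φ.obj (op Z, Z) ≅ Z := z
  -- The algebra morphism equations for `(q, d)`, solved for `q` and `d`; by initiality `(q, d)` is
  -- the only fixed point.
  let Ψ : (X ⟶ Z) × (Z ⟶ X) → (X ⟶ Z) × (Z ⟶ X) := fun w =>
    (x.hom ≫ bimap Φ.toFunctor w.2 w.1 ≫ z'.hom, z'.inv ≫ bimap Φ.toFunctor w.1 w.2 ≫ x.inv)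
  have hΨ : ωScottContinuous Ψ := Prod.ωScottContinuous.prodMk
    (ωScottContinuous_comp .const (ωScottContinuous_comp (ωScottContinuous_bimap Φ
      Prod.ωScottContinuous_snd Prod.ωScottContinuous_fst) .const))
    (ωScottContinuous_comp .const (ωScottContinuous_comp (ωScottContinuous_bimap Φ
      Prod.ωScottContinuous_fst Prod.ωScottContinuous_snd) .const))
  have huniq (w) (hw : Ψ w = w) : w = (f.q, f.d) := by
    obtain ⟨h₁, h₂⟩ := Prod.ext_iff.1 hw
    refine (existsUnique_of_isDiagonalInitial hz T).unique (y₁ := w) (y₂ := (f.q, f.d))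
      ⟨?_, ?_⟩ ⟨f.hom_d, f.q_inv⟩
    · exact ((Iso.inv_comp_eq z).1 h₂).symm
    · exact ((Iso.comp_inv_eq z).2 (h₁.symm.trans (Category.assoc _ _ _).symm))
  have hqd : f.q ≫ f.d ≤ 𝟙 X := by
    -- The invariant is `w.1 ≫ w.2 ≤ 𝟙 X`. Strictness gives it at bottom, and `Ψ` replaces `w.1 ≫
    -- w.2` by its image under `Φ` in both arguments, conjugated by `x`.
    refine unique_fixedPoint_induction hΨ (x := (bot X Z, bot Z X))
      ⟨hbot _ _ _, hbot _ _ _⟩ huniq (fun w => w.1 ≫ w.2 ≤ 𝟙 X)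
      ((hcomp _ _ _ _).trans_le (hbot _ _ _)) (fun w hw => ?_) fun c hc =>
      (ωSup_comp_ωSup (c.map OrderHom.fst) (c.map OrderHom.snd)).trans_le (ωSup_le _ _ hc)
    have h := comp_mono (le_refl x.hom) (comp_mono (bimap_mono Φ hw hw) (le_refl x.inv))
    simpa [Ψ] using h
  -- Monotonicity of `F` into `Drop R` carries the inequality from `D` to the possibly finer order
  -- on dropped transformations.
  have h := comp_mono (le_refl T.iso.hom) (comp_mono (bimap_mono F hqd hqd) (le_refl T.iso.inv))
  have h₁ : f.p ≫ f.e = T.iso.hom ≫ bimap F.toFunctor (f.q ≫ f.d) (f.q ≫ f.d) ≫ T.iso.inv := by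
    rw [f.p_eq, f.e_eq]
    exact (Category.assoc _ _ _).trans
      (congrArg (T.iso.hom ≫ ·) (bimap_comp_assoc F.toFunctor _ _ _ _ _))
  refine h₁.trans_le (h.trans_eq ?_)
  rw [bimap_id, Category.id_comp, T.iso.hom_inv_id]

end Solution

end Solutions

end HigherOrder

open HigherOrder Limits in
theorem mainTheorem4
    {C : Type u₁} [Category.{v₁} C] [CpoCategory C]
    {D : Type u₂} [Category.{v₂} D] [CpoCategory D]
    (hD : IsCpoAlgebraicallyCompact D)
    (R : CpoFunctor C D) (hR : FinalInvariantsDrop R)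
    (ν : FinalCoalgebras (dropInclusion R))
    (F : CpoFunctor (Dᵒᵖ × D) (Drop R)) :
    ∃ (Z : D) (z : (F.toFunctor ⋙ behaviour ν).obj (op Z, Z) ≅ Z),
      Nonempty (IsInitial (symmetricAlgebra z)) ∧
      Nonempty (IsTerminal (symmetricCoalgebra z)) ∧
      (Solution.ofFixedPoint z : Solution F ν).IsDominating ∧
      (∀ S : Solution F ν, S.IsDominating →
        (Solution.ofFixedPoint z : Solution F ν).IsIsomorphic S) ∧
      (IsCpoBotEnriched D → ∀ (T : Solution F ν) (f : Solution.Hom (Solution.ofFixedPoint z) T),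
        f.p ≫ f.e ≤ 𝟙 T.H) := by
  obtain ⟨Z, z, hz⟩ := hD.exists_diagonal_fixedPoint (F.comp (cpoBehaviour ν))
  have hz : IsDiagonalInitial (F.toFunctor ⋙ behaviour ν) z := hz
  exact ⟨Z, z, hz.nonempty_isInitial, hz.nonempty_isTerminal,
    Solution.isDominating_of_isDiagonalInitial hz,
    fun _ => Solution.isIsomorphic_of_isDiagonalInitial hz, fun h _ => Solution.Hom.p_e_le_id hz h⟩
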